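/- **Setting.** Let $D$ be a small category with a small family $K$ of cones; the cone $c\in K$ has peak $\mathrm{ou}(c)\in D$ and base a functor $\mathrm{in}(c):\mathrm{Es}(c)\to D$ with $\mathrm{Es}(c)$ small. Let $\mathcal C$ be a cocomplete category with limits of shape $\mathrm{Es}(c)$ for every $c$. For $A\in\mathcal C^D$ put $A[c]=\lim(A\circ \mathrm{in}(c))$, with its canonical arrow $A(\mathrm{ou}(c))\to A[c]$. For each $c$ let $V_c$ be a small family of commutative squares $\beta_1\gamma_1=\beta_2\gamma_2$ in $\mathcal C$, where $\gamma_i:\mathbb S\to\mathbb D_i$ and $\beta_i:\mathbb D_i\to\mathbb D'$, each equipped with a pushout $\mathbb D_1\xrightarrow{\delta_1}\mathbb S'\xleftarrow{\delta_2}\mathbb D_2$ of $\gamma_1,\gamma_2$; let $\beta:\mathbb S'\to\mathbb D'$ be the arrow induced by $\beta_1,\beta_2$. A *lifting problem* posed to $A$ by a square of $V_c$ is a pair $x:\mathbb S\to A(\mathrm{ou}(c))$, $y:\mathbb D_1\to A[c]$ such that $\mathbb S\xrightarrow{x}A(\mathrm{ou}(c))\to A[c]$ equals $y\gamma_1$.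 A functor $X\in\mathcal C^D$ is a *model* if for each such lifting problem posed to $X$ there are $h:\mathbb D_2\to X(\mathrm{ou}(c))$ and $k:\mathbb D'\to X[c]$ with $h\gamma_2=x$, $k\beta_1=y$ and $\mathbb D_2\xrightarrow{h}X(\mathrm{ou}(c))\to X[c]$ equal to $k\beta_2$. **Construction of $i:A\to Q(A)$.** Fix a limit ordinal $\kappa>0$. A *quotient* $q$ on $A$ is a choice, for every $c\in K$ and every square in $V_c$, of a set of arrows $\mathbb S'\to A[c]$. Given $(A,q)$, let $A\to[A/q]$ be the arrow of $\mathcal C^D$ obtained as a pushout, objectwise on $D$ and functorially, by attaching to $A(d)$ the following cells: * a copy of $\gamma_2:\mathbb S\to\mathbb D_2$ along $\mathbb S\xrightarrow{x}A(\mathrm{ou}(c))\xrightarrow{A(t)}A(d)$, for all $c$, all squares in $V_c$, all lifting problems $(x,y)$ posed to $A$ by them, and all $t:\mathrm{ou}(c)\to d$ in $D$; * for each arrow $b$ of $\mathcal C$ that occurs as the arrow $\beta$ of some square, a copy of $b$ along each arrow that can be written as a composite $\mathbb S'\xrightarrow{w}A[c]\to A(\mathrm{in}(c)(z))\xrightarrow{A(t)}A(d)$,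 for some $c$, some square in $V_c$ with $\beta=b$, some $w$ in the set that $q$ chooses for this square, $z\in \mathrm{Es}(c)$ and $t:\mathrm{in}(c)(z)\to d$ (one copy for each such arrow, not for each way of writing it). The *rectification* of $q$ is the quotient on $[A/q]$ which consists, for every square, of the arrows $\mathbb S'\to[A/q][c]$, one for each lifting problem $(x,y)$ posed to $A$ by this square, that are equal to $\mathbb D_1\xrightarrow{y}A[c]\to[A/q][c]$ on $\mathbb D_1$ and to $\mathbb D_2\to[A/q](\mathrm{ou}(c))\to[A/q][c]$ on $\mathbb D_2$, where $\mathbb D_2\to[A/q](\mathrm{ou}(c))$ is the copy of $\mathbb D_2$ attached for $(x,y)$ and $t=\mathrm{id}$. Define $(A_n,q_n)$ for $n\le\kappa$ by $A_0=A$, $q_0=\emptyset$; $A_{n+1}=[A_n/q_n]$ and $q_{n+1}$ the rectification of $q_n$; and, for a limit ordinal $\lambda\le\kappa$, $A_\lambda=\operatorname{colim}_{n<\lambda}A_n$ and $q_\lambda=\emptyset$. Let $Q(A)=A_\kappa$ and let $i:A\to Q(A)$ be the transfinite composite. **Theorem 1.1.** For every $A\in\mathcal C^D$, the arrow $i:A\to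 Q(A)$ has the following property: for every arrow $f:A\to X$ in $\mathcal C^D$ where $X$ is a model, if 1. $\beta:\mathbb S'\to\mathbb D'$ is an epimorphism for every $c\in K$ and every square in $V_c$, 2. $X(\mathrm{ou}(c))\to X[c]$ is a monomorphism for every $c\in K$, 3. $\beta_1:\mathbb D_1\to\mathbb D'$ is an epimorphism for every $c\in K$ and every square in $V_c$, then there is a unique arrow $g:Q(A)\to X$ such that $g\circ i=f$. -/

import Mathlib

open CategoryTheory CategoryTheory.Limits Opposite

universe v u

noncomputable section

/-- A commutative square `γ₁ ≫ β₁ = γ₂ ≫ β₂` in `C` (`β₁ = δ₁ ≫ β`, `β₂ = δ₂ ≫ β`), equipped with a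
pushout `S'` of `γ₁` and `γ₂` and with the arrow `β : S' ⟶ D'` induced by `β₁` and `β₂`. -/
structure Vertebra (C : Type u) [Category.{v} C] where
  S : C
  D₁ : C
  D₂ : C
  S' : C
  D' : C
  γ₁ : S ⟶ D₁
  γ₂ : S ⟶ D₂
  δ₁ : D₁ ⟶ S'
  δ₂ : D₂ ⟶ S'
  isPushout : IsPushout γ₁ γ₂ δ₁ δ₂
  β : S' ⟶ D'

namespace Vertebra

variable {C : Type u} [Category.{v} C] (w : Vertebra C)

/-- The right-hand side `D₁ ⟶ D'` of the square. -/
def β₁ : w.D₁ ⟶ w.D' := w.δ₁ ≫ w.β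

/-- The lower side `D₂ ⟶ D'` of the square. -/
def β₂ : w.D₂ ⟶ w.D' := w.δ₂ ≫ w.β

end Vertebra

/-- A limit sketch on the small category `D` (a small family `K` of cones, the cone `c` having the
small elementary shape `Es c`) together with, for each cone `c`, a small family `V c` of commutative
squares in `C`.  The category of premodels is the whole functor category `D ⥤ C`. -/
structure PremodelSystem (D : Type v) [SmallCategory D] (C : Type u) [Category.{v} C] where
  K : Type v
  Es : K → Type v
  [category : ∀ c, SmallCategory (Es c)]
  /-- the functor `in(c)` -/
  diag : ∀ c, Es c ⥤ D
  cone : ∀ c, Cone (diag c)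
  V : K → Type v
  vert : ∀ c, V c → Vertebra C

namespace PremodelSystem

attribute [instance] PremodelSystem.category

variable {D : Type v} [SmallCategory D] {C : Type u} [Category.{v} C]
variable (P : PremodelSystem D C)

/-- The peak `ou(c)` of the cone `c`. -/
abbrev ou (c : P.K) : D := (P.cone c).pt

variable [∀ c, HasLimitsOfShape (P.Es c) C]

/-- The object `A[c] = lim (A ∘ in(c))`. -/
abbrev lim (c : P.K) (A : D ⥤ C) : C := limit (P.diag c ⋙ A)

/-- The projection `A[c] ⟶ A(in(c)(z))`. -/
abbrev proj (c : P.K) (A : D ⥤ C) (z : P.Es c) : P.lim c A ⟶ A.obj ((P.diag c).obj z) :=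
  limit.π (P.diag c ⋙ A) z

/-- The functoriality of `A ↦ A[c]`. -/
def limMap (c : P.K) {A B : D ⥤ C} (f : A ⟶ B) : P.lim c A ⟶ P.lim c B :=
  Limits.limMap (Functor.whiskerLeft (P.diag c) f)

/-- The canonical arrow `A(ou(c)) ⟶ A[c]`. -/
def can (c : P.K) (A : D ⥤ C) : A.obj (P.ou c) ⟶ P.lim c A :=
  limit.lift (P.diag c ⋙ A) (A.mapCone (P.cone c))

theorem can_naturality (c : P.K) {A B : D ⥤ C} (f : A ⟶ B) :
    f.app (P.ou c) ≫ P.can c B = P.can c A ≫ P.limMap c f := by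
  apply limit.hom_ext
  intro z
  have h₁ : P.can c B ≫ limit.π (P.diag c ⋙ B) z = B.map ((P.cone c).π.app z) :=
    limit.lift_π _ _
  have h₂ : P.can c A ≫ limit.π (P.diag c ⋙ A) z = A.map ((P.cone c).π.app z) :=
    limit.lift_π _ _
  have h₃ : P.limMap c f ≫ limit.π (P.diag c ⋙ B) z =
      limit.π (P.diag c ⋙ A) z ≫ f.app ((P.diag c).obj z) :=
    limMap_π _ _
  rw [Category.assoc, Category.assoc, h₁, h₃, ← Category.assoc, h₂]
  exact (f.naturality _).symm

/-- A functor `X` is a model if every arrow `X(ou(c)) ⟶ X[c]` has, in the arrow category, the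
(weak) right lifting property with respect to all the squares in `V c`. -/
def IsModel (X : D ⥤ C) : Prop :=
  ∀ (c : P.K) (v : P.V c) (x : (P.vert c v).S ⟶ X.obj (P.ou c)) (y : (P.vert c v).D₁ ⟶ P.lim c X),
    x ≫ P.can c X = (P.vert c v).γ₁ ≫ y →
    ∃ (h : (P.vert c v).D₂ ⟶ X.obj (P.ou c)) (k : (P.vert c v).D' ⟶ P.lim c X),
      (P.vert c v).γ₂ ≫ h = x ∧ (P.vert c v).β₁ ≫ k = y ∧ h ≫ P.can c X = (P.vert c v).β₂ ≫ k

/-- The lifting problems posed by `v ∈ V c` to `A`: the commutative squares from `γ₁` to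
`A(ou(c)) ⟶ A[c]`. -/
structure Problem (A : D ⥤ C) (c : P.K) (v : P.V c) where
  x : (P.vert c v).S ⟶ A.obj (P.ou c)
  y : (P.vert c v).D₁ ⟶ P.lim c A
  comm : x ≫ P.can c A = (P.vert c v).γ₁ ≫ y

/-- A quotient on `A` (relative to the terminal arrow of `A`): for each `v ∈ V c`, a set of arrows
`S' ⟶ A[c]`, which are to be extended along the stem `β : S' ⟶ D'`. -/
abbrev QuotientData (A : D ⥤ C) : Type v :=
  ∀ (c : P.K) (v : P.V c), Set ((P.vert c v).S' ⟶ P.lim c A)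

end PremodelSystem

/-- Cells to be attached to `A : D ⥤ C`: for each index `i` an arrow `arr i : U ⟶ W` of `C` and, for
each `d`, a set of attaching arrows `U ⟶ A(d)`, functorially in `d`. -/
structure Tome {D : Type v} [SmallCategory D] {C : Type u} [Category.{v} C] (A : D ⥤ C) where
  ι : Type v
  arr : ι → Arrow C
  cell : ι → D ⥤ Type v
  att : ∀ i, cell i ⟶ A ⋙ coyoneda.obj (op (arr i).left)

namespace Tome

variable {D : Type v} [SmallCategory D] {C : Type u} [Category.{v} C] [HasColimits C]
variable {A : D ⥤ C} (T : Tome A)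

/-- `d ↦` the coproduct of the sources `U` of all the cells at `d`. -/
abbrev colDom : D ⥤ C := ∐ fun i => T.cell i ⋙ sigmaConst.obj (T.arr i).left

/-- `d ↦` the coproduct of the targets `W` of all the cells at `d`. -/
abbrev colCod : D ⥤ C := ∐ fun i => T.cell i ⋙ sigmaConst.obj (T.arr i).right

/-- The coproduct of the arrows `U ⟶ W`. -/
def colArr : T.colDom ⟶ T.colCod :=
  Limits.Sigma.map fun i => Functor.whiskerLeft (T.cell i) (sigmaConst.map (T.arr i).hom)

/-- The arrow to `A` whose components are the attaching arrows. -/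
def content : T.colDom ⟶ A :=
  Limits.Sigma.desc fun i =>
    { app := fun d => Limits.Sigma.desc fun s => ((T.att i).app d s : (T.arr i).left ⟶ A.obj d)
      naturality := by
        intro d d' t
        apply Limits.Sigma.hom_ext
        intro s
        simp }

/-- The pushout of `A` obtained by attaching all the cells. -/
abbrev realisation : D ⥤ C := pushout T.content T.colArr

/-- The canonical arrow from `A` to its realisation. -/
def toRealisation : A ⟶ T.realisation := pushout.inl T.content T.colArr

/-- The arrow `W ⟶ realisation(d)` filling the cell `s`. -/
def fill (i : T.ι) {d : D} (s : (T.cell i).obj d) : (T.arr i).right ⟶ T.realisation.obj d :=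
  Limits.Sigma.ι (fun _ : (T.cell i).obj d => (T.arr i).right) s ≫
    (Limits.Sigma.ι (fun i => T.cell i ⋙ sigmaConst.obj (T.arr i).right) i ≫
      pushout.inr T.content T.colArr).app d

theorem fill_fac (i : T.ι) {d : D} (s : (T.cell i).obj d) :
    (T.arr i).hom ≫ T.fill i s =
      ((T.att i).app d s : (T.arr i).left ⟶ A.obj d) ≫ T.toRealisation.app d := by
  have h := NatTrans.congr_app (pushout.condition (f := T.content) (g := T.colArr)) d
  have h' := congrArg (fun k => Limits.Sigma.ι (fun _ : (T.cell i).obj d => (T.arr i).left) s ≫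
    (Limits.Sigma.ι (fun i => T.cell i ⋙ sigmaConst.obj (T.arr i).left) i).app d ≫ k) h
  have h₁ : (Limits.Sigma.ι (fun i => T.cell i ⋙ sigmaConst.obj (T.arr i).left) i).app d ≫
      T.content.app d =
        Limits.Sigma.desc fun s => ((T.att i).app d s : (T.arr i).left ⟶ A.obj d) := by
    rw [← NatTrans.comp_app, content, Limits.Sigma.ι_desc]
  have h₂ : (Limits.Sigma.ι (fun i => T.cell i ⋙ sigmaConst.obj (T.arr i).left) i).app d ≫
      T.colArr.app d = (sigmaConst.map (T.arr i).hom).app ((T.cell i).obj d) ≫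
        (Limits.Sigma.ι (fun i => T.cell i ⋙ sigmaConst.obj (T.arr i).right) i).app d := by
    rw [← NatTrans.comp_app, colArr, Limits.Sigma.ι_map]
    rfl
  simp only [NatTrans.comp_app] at h'
  rw [reassoc_of% h₁, reassoc_of% h₂] at h'
  simp only [fill, toRealisation, NatTrans.comp_app]
  simpa using h'.symm

end Tome

namespace PremodelSystem

variable {D : Type v} [SmallCategory D] {C : Type u} [Category.{v} C]
variable (P : PremodelSystem D C) [∀ c, HasLimitsOfShape (P.Es c) C]

/-- The stem `β : S' ⟶ D'` of `v ∈ V c`, as an object of the arrow category. -/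
def stem (θ : Σ c, P.V c) : Arrow C := Arrow.mk (P.vert θ.1 θ.2).β

/-- The set of the stems of the system. -/
def Stems : Type v := Quotient (Setoid.ker P.stem)

/-- The stem represented by an element of `Stems`. -/
def Stems.arr {P : PremodelSystem D C} (b : P.Stems) : Arrow C :=
  Quotient.lift P.stem (fun _ _ h => h) b

/-- The image of the quotient tome of `q`: the arrows `S' ⟶ A(d)` of the form
`S' ⟶ A[c] ⟶ A(in(c)(z)) ⟶ A(d)`, the first arrow being in `q c v` and the last one being the image
of an arrow `t : in(c)(z) ⟶ d` of `D`. -/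
inductive IsQuotientCell {A : D ⥤ C} (q : P.QuotientData A) :
    (b : P.Stems) → (d : D) → (b.arr.left ⟶ A.obj d) → Prop
  | mk (c : P.K) (v : P.V c) (w : (P.vert c v).S' ⟶ P.lim c A) (hw : w ∈ q c v) (z : P.Es c)
      (d : D) (t : (P.diag c).obj z ⟶ d) :
      IsQuotientCell q (Quotient.mk _ ⟨c, v⟩) d (w ≫ P.proj c A z ≫ A.map t)

/-- For a given stem `b`, the functor of the quotient cells, as a subfunctor of `Hom(S', A(-))`. -/
def quotientCell {A : D ⥤ C} (q : P.QuotientData A) (b : P.Stems) :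
    Subfunctor (A ⋙ coyoneda.obj (op b.arr.left)) where
  obj d := { u | P.IsQuotientCell q b d u }
  map := by
    rintro d d' t u ⟨c, v, w, hw, z, _, s⟩
    have h : (w ≫ P.proj c A z ≫ A.map s) ≫ A.map t = w ≫ P.proj c A z ≫ A.map (s ≫ t) := by
      rw [A.map_comp, Category.assoc, Category.assoc]
    exact Eq.mpr (congrArg (P.IsQuotientCell q (Quotient.mk _ ⟨c, v⟩) d') h)
      (IsQuotientCell.mk c v w hw z d' (s ≫ t))

/-- The cells attached to `A` at one step of the construction.  The analytic cells at `d` are the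
arrows `γ₂ : S ⟶ D₂`, one for each `c`, `v ∈ V c`, each lifting problem `(x, y)` posed by `v` to `A` and
each `t : ou(c) ⟶ d`, attached along `S ⟶ A(ou(c)) ⟶ A(d)`.  The quotient cells at `d` are the stems
`β : S' ⟶ D'` attached along the arrows in the image of the quotient tome of `q`. -/
def tome (A : D ⥤ C) (q : P.QuotientData A) : Tome A where
  ι := (Σ (c : P.K) (v : P.V c), P.Problem A c v) ⊕ P.Stems
  arr := Sum.elim (fun a => Arrow.mk (P.vert a.1 a.2.1).γ₂) (fun b => b.arr)
  cell := Sum.elim (fun a => coyoneda.obj (op (P.ou a.1))) (fun b => (P.quotientCell q b).toFunctor)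
  att
    | .inl a => { app := fun d => ↾fun (t : P.ou a.1 ⟶ d) => a.2.2.x ≫ A.map t }
    | .inr b => (P.quotientCell q b).ι

variable [HasColimits C]

/-- The object `[A/q]`. -/
def step (A : D ⥤ C) (q : P.QuotientData A) : D ⥤ C := (P.tome A q).realisation

/-- The arrow `A ⟶ [A/q]`. -/
def toStep (A : D ⥤ C) (q : P.QuotientData A) : A ⟶ P.step A q := (P.tome A q).toRealisation

/-- The arrow `D₂ ⟶ [A/q](ou(c))` given by the analytic cell of a lifting problem at the
identity of `ou(c)`. -/
def π₀ {A : D ⥤ C} (q : P.QuotientData A) {c : P.K} {v : P.V c} (a : P.Problem A c v) :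
    (P.vert c v).D₂ ⟶ (P.step A q).obj (P.ou c) :=
  (P.tome A q).fill (.inl ⟨c, v, a⟩) (𝟙 (P.ou c))

theorem π₀_fac {A : D ⥤ C} (q : P.QuotientData A) {c : P.K} {v : P.V c} (a : P.Problem A c v) :
    (P.vert c v).γ₂ ≫ P.π₀ q a = a.x ≫ (P.toStep A q).app (P.ou c) := by
  have h := (P.tome A q).fill_fac (.inl ⟨c, v, a⟩) (𝟙 (P.ou c))
  refine h.trans (congrArg (· ≫ (P.toStep A q).app (P.ou c)) ?_)
  exact (congrArg (a.x ≫ ·) (A.map_id _)).trans (Category.comp_id _)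

/-- The obstruction `S' ⟶ [A/q][c]` of a lifting problem `(x, y)`: it is the composite
`D₁ ⟶ A[c] ⟶ [A/q][c]` on `D₁` and the composite `D₂ ⟶ [A/q](ou(c)) ⟶ [A/q][c]` on `D₂`. -/
def obstruction {A : D ⥤ C} (q : P.QuotientData A) {c : P.K} {v : P.V c} (a : P.Problem A c v) :
    (P.vert c v).S' ⟶ P.lim c (P.step A q) :=
  (P.vert c v).isPushout.desc (a.y ≫ P.limMap c (P.toStep A q)) (P.π₀ q a ≫ P.can c (P.step A q))
    (by
      rw [← Category.assoc, ← a.comm, ← Category.assoc, π₀_fac, Category.assoc, Category.assoc,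
        can_naturality])

/-- The rectification of `q`: the quotient on `[A/q]` which consists of the obstructions of all the
lifting problems posed to `A`. -/
def rectification (A : D ⥤ C) (q : P.QuotientData A) : P.QuotientData (P.step A q) :=
  fun _ _ => Set.range fun a => P.obstruction q a

/-- The pairs `(Aₙ, qₙ)`, `n < ω`, starting from `(A, ∅)`, with `Aₙ₊₁ = [Aₙ/qₙ]` and `qₙ₊₁` the
rectification of `qₙ`. -/
def stage (A : D ⥤ C) : ℕ → Σ B : D ⥤ C, P.QuotientData B
  | 0 => ⟨A, fun _ _ => ∅⟩
  | n + 1 => ⟨P.step (stage A n).1 (stage A n).2, P.rectification (stage A n).1 (stage A n).2⟩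

/-- The sequence `A = A₀ ⟶ A₁ ⟶ A₂ ⟶ ...`. -/
def chain (A : D ⥤ C) : ℕ ⥤ (D ⥤ C) :=
  Functor.ofSequence (X := fun n => (P.stage A n).1)
    fun n => P.toStep (P.stage A n).1 (P.stage A n).2

/-- The object `A_ω = colim Aₙ`. -/
def omegaStage (A : D ⥤ C) : D ⥤ C := colimit (P.chain A)

/-- The arrow `A ⟶ A_ω`. -/
def toOmegaStage (A : D ⥤ C) : A ⟶ P.omegaStage A := colimit.ι (P.chain A) 0

/-- In the transfinite sequence `(Aₙ, qₙ)`, at a limit ordinal `l` the object `A_l` is the colimit of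
the previous ones and `q_l` is empty, so that `A_{l + n}` for `n ≤ ω` is obtained from `A_l` in the same
way as `A_n` is obtained from `A`. The limit stages are hence the iterates of `A ↦ A_ω`. -/
def iter (A : D ⥤ C) : SmallObject.SuccStruct (D ⥤ C) where
  X₀ := A
  succ := P.omegaStage
  toSucc := P.toOmegaStage

instance (α : Ordinal.{v}) : Nonempty (Order.succ α).ToType := ⟨⊤⟩

instance orderBotToTypeSucc (α : Ordinal.{v}) : OrderBot (Order.succ α).ToType :=
  WellFoundedLT.toOrderBot _

/-- For a limit ordinal `κ = ω * α`, the object `A_κ`, that is the `α`-th iterate of `A ↦ A_ω`. -/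
def Q (κ : Ordinal.{v}) (A : D ⥤ C) : D ⥤ C :=
  (P.iter A).iteration (Order.succ (κ / Ordinal.omega0)).ToType

/-- The arrow `i : A ⟶ Q(A)`, for a limit ordinal `κ`. -/
def toQ (κ : Ordinal.{v}) (A : D ⥤ C) : A ⟶ P.Q κ A :=
  (P.iter A).ιIteration (Order.succ (κ / Ordinal.omega0)).ToType

end PremodelSystem

end

/-!
A cell attached to `A` on account of a lifting problem `(x, y)` is a copy of `γ₂ : S ⟶ D₂`, and an
extension of `f : A ⟶ X` to it is an arrow `h : D₂ ⟶ X(ou(c))` with `γ₂ ≫ h` prescribed. If `X` is a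
model, such an `h` exists which is part of a solution `(h, k)` of the image of the problem in `X`;
and the solution is unique, since `β₁` being an epimorphism determines `k` from `y`, and
`X(ou(c)) ⟶ X[c]` being a monomorphism determines `h` from `k` (`Problem.IsSolution.eq`). The
extension is moreover part of a solution exactly when it sends the obstruction of the problem, an
arrow in the rectification of the quotient, to an arrow which factors through the stem `β`
(`compatible_rectification_iff`).

Call an arrow to `X` compatible with a quotient `q` if it sends all the arrows in `q` to arrows which
factor through the stems. A compatible arrow `A ⟶ X` extends to an arrow `[A/q] ⟶ X` compatible
with the rectification (`exists_step_desc`), in only one way (`step_hom_ext`). On the other hand any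
arrow `A ⟶ X` which extends to `[A/q]` is compatible with `q`, because of the quotient cells
(`compatible_toStep_comp`). As the initial quotient is empty, every `A ⟶ X` extends stage by stage to
`A_ω`; and as the restriction to `Aₙ` of an arrow `A_ω ⟶ X` extends to `Aₙ₊₁`, it is compatible with
`qₙ`, so that the extension is unique (`existsUnique_omegaStage_desc`). Unique extension of arrows
to `X` passes to transfinite composites.
-/

/-! ### Arrows out of the realisation of a tome -/

namespace Tome

variable {D : Type v} [SmallCategory D] {C : Type u} [Category.{v} C] [HasColimits C]
variable {A : D ⥤ C} (T : Tome A)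

theorem fill_map (i : T.ι) {d d' : D} (s : (T.cell i).obj d) (t : d ⟶ d') :
    T.fill i s ≫ T.realisation.map t = T.fill i ((T.cell i).map t s) := by
  simp only [fill, Category.assoc]
  rw [← NatTrans.naturality]
  simp

/-- Two arrows out of the realisation agree if they agree on `A` and on all the cells. -/
theorem realisation_hom_ext {X : D ⥤ C} {g g' : T.realisation ⟶ X}
    (h : T.toRealisation ≫ g = T.toRealisation ≫ g')
    (hc : ∀ (i : T.ι) (d : D) (s : (T.cell i).obj d),
      T.fill i s ≫ g.app d = T.fill i s ≫ g'.app d) : g = g' := by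
  refine pushout.hom_ext h ?_
  apply Limits.Sigma.hom_ext
  intro i
  ext d : 2
  apply Limits.Sigma.hom_ext
  intro s
  simpa [fill] using hc i d s

/-- An arrow `f : A ⟶ X` extends to the realisation, with prescribed values on the cells, as soon as
these values are compatible with `f` and natural. -/
theorem exists_realisation_desc {X : D ⥤ C} (f : A ⟶ X)
    (φ : ∀ (i : T.ι) (d : D) (_ : (T.cell i).obj d), (T.arr i).right ⟶ X.obj d)
    (hφ : ∀ (i : T.ι) (d : D) (s : (T.cell i).obj d), (T.arr i).hom ≫ φ i d s =
      ((T.att i).app d s : (T.arr i).left ⟶ A.obj d) ≫ f.app d)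
    (hφ' : ∀ (i : T.ι) (d d' : D) (t : d ⟶ d') (s : (T.cell i).obj d),
      φ i d s ≫ X.map t = φ i d' ((T.cell i).map t s)) :
    ∃ g : T.realisation ⟶ X, T.toRealisation ≫ g = f ∧
      ∀ (i : T.ι) (d : D) (s : (T.cell i).obj d), T.fill i s ≫ g.app d = φ i d s := by
  let ψ : T.colCod ⟶ X := Limits.Sigma.desc fun i =>
    { app := fun d => Limits.Sigma.desc fun s => φ i d s
      naturality := by
        intro d d' t
        apply Limits.Sigma.hom_ext
        intro s
        simp [hφ'] }
  have hψ : T.content ≫ f = T.colArr ≫ ψ := by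
    apply Limits.Sigma.hom_ext
    intro i
    ext d : 2
    apply Limits.Sigma.hom_ext
    intro s
    simp only [content, colArr, ψ, Limits.Sigma.ι_desc_assoc, Limits.Sigma.ι_map_assoc,
      Limits.Sigma.ι_desc]
    simp [hφ]
  refine ⟨pushout.desc f ψ hψ, pushout.inl_desc _ _ _, fun i d s => ?_⟩
  simp only [fill, Category.assoc]
  rw [← NatTrans.comp_app, Category.assoc, pushout.inr_desc]
  simp [ψ]

end Tome

/-! ### Compatible arrows and solutions of lifting problems -/

namespace PremodelSystem

variable {D : Type v} [SmallCategory D] {C : Type u} [Category.{v} C]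
variable (P : PremodelSystem D C)

theorem epi_stem (h₁ : ∀ (c : P.K) (w : P.V c), Epi (P.vert c w).β) (b : P.Stems) :
    Epi b.arr.hom := by
  induction b using Quotient.ind with
  | _ θ => exact h₁ θ.1 θ.2

variable [∀ c, HasLimitsOfShape (P.Es c) C]

theorem limMap_proj (c : P.K) {A B : D ⥤ C} (f : A ⟶ B) (z : P.Es c) :
    P.limMap c f ≫ P.proj c B z = P.proj c A z ≫ f.app ((P.diag c).obj z) :=
  Limits.limMap_π _ _

theorem proj_map (c : P.K) (A : D ⥤ C) {z z' : P.Es c} (t : z ⟶ z') :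
    P.proj c A z ≫ A.map ((P.diag c).map t) = P.proj c A z' :=
  limit.w (P.diag c ⋙ A) t

theorem limMap_comp (c : P.K) {A B E : D ⥤ C} (f : A ⟶ B) (g : B ⟶ E) :
    P.limMap c (f ≫ g) = P.limMap c f ≫ P.limMap c g := by
  apply limit.hom_ext
  intro z
  simp [limMap]

/-- An arrow `f : A ⟶ X` is compatible with the quotient `q` on `A` if it sends every arrow
`S' ⟶ A[c]` in `q` to an arrow `S' ⟶ X[c]` that factors through the stem `β : S' ⟶ D'`. -/
def Compatible {A X : D ⥤ C} (q : P.QuotientData A) (f : A ⟶ X) : Prop :=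
  ∀ (c : P.K) (v : P.V c), ∀ w ∈ q c v,
    ∃ k : (P.vert c v).D' ⟶ P.lim c X, (P.vert c v).β ≫ k = w ≫ P.limMap c f

theorem Compatible.exists_stem_fac {P : PremodelSystem D C} [∀ c, HasLimitsOfShape (P.Es c) C]
    {A X : D ⥤ C} {q : P.QuotientData A} {f : A ⟶ X}
    (hf : P.Compatible q f) {b : P.Stems} {d : D} {u : b.arr.left ⟶ A.obj d}
    (hu : P.IsQuotientCell q b d u) :
    ∃ k : b.arr.right ⟶ X.obj d, b.arr.hom ≫ k = u ≫ f.app d := by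
  obtain ⟨c, v, w, hw, z, _, t⟩ := hu
  obtain ⟨k, hk⟩ := hf c v w hw
  refine ⟨k ≫ P.proj c X z ≫ X.map t, ?_⟩
  change (P.vert c v).β ≫ k ≫ P.proj c X z ≫ X.map t = (w ≫ P.proj c A z ≫ A.map t) ≫ f.app _
  rw [reassoc_of% hk, reassoc_of% P.limMap_proj c f z]
  simp

/-- The image of a lifting problem under an arrow `f : A ⟶ X`. -/
@[simps]
noncomputable def Problem.map {P : PremodelSystem D C} [∀ c, HasLimitsOfShape (P.Es c) C]
    {A X : D ⥤ C} {c : P.K} {v : P.V c} (a : P.Problem A c v) (f : A ⟶ X) : P.Problem X c v where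
  x := a.x ≫ f.app (P.ou c)
  y := a.y ≫ P.limMap c f
  comm := by
    rw [Category.assoc, can_naturality, ← Category.assoc, a.comm, Category.assoc]

/-- The arrow `h` is the component `D₂ ⟶ X(ou(c))` of a solution `(h, k)` of the lifting problem
`a`. -/
def Problem.IsSolution {P : PremodelSystem D C} [∀ c, HasLimitsOfShape (P.Es c) C]
    {X : D ⥤ C} {c : P.K} {v : P.V c} (a : P.Problem X c v)
    (h : (P.vert c v).D₂ ⟶ X.obj (P.ou c)) : Prop :=
  (P.vert c v).γ₂ ≫ h = a.x ∧ ∃ k : (P.vert c v).D' ⟶ P.lim c X,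
    (P.vert c v).β₁ ≫ k = a.y ∧ h ≫ P.can c X = (P.vert c v).β₂ ≫ k

/-- If `β₁` is an epimorphism and `X(ou(c)) ⟶ X[c]` is a monomorphism, solutions are unique: `k` is
determined by `y`, and `h` by `k`. -/
theorem Problem.IsSolution.eq {P : PremodelSystem D C} [∀ c, HasLimitsOfShape (P.Es c) C]
    {X : D ⥤ C} {c : P.K} {v : P.V c} {a : P.Problem X c v}
    [Mono (P.can c X)] [Epi (P.vert c v).β₁]
    {h h' : (P.vert c v).D₂ ⟶ X.obj (P.ou c)} (H : a.IsSolution h) (H' : a.IsSolution h') :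
    h = h' := by
  obtain ⟨-, k, hk, e⟩ := H
  obtain ⟨-, k', hk', e'⟩ := H'
  obtain rfl : k = k' := by rw [← cancel_epi (P.vert c v).β₁, hk, hk']
  rw [← cancel_mono (P.can c X), e, e']

variable [HasColimits C]

theorem fill_inl {A : D ⥤ C} (q : P.QuotientData A) {c : P.K} {v : P.V c} (a : P.Problem A c v)
    {d : D} (t : P.ou c ⟶ d) :
    (P.tome A q).fill (.inl ⟨c, v, a⟩) t = P.π₀ q a ≫ (P.step A q).map t := by
  refine Eq.trans ?_ ((P.tome A q).fill_map (.inl ⟨c, v, a⟩) (𝟙 (P.ou c)) t).symm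
  exact congrArg ((P.tome A q).fill (.inl ⟨c, v, a⟩)) (Category.id_comp t).symm

/-! ### Extension along one step of the construction -/

section

variable {A X : D ⥤ C} {q : P.QuotientData A}

/-- The quotient cells of `[A/q]` provide, for each `w` in `q`, the components at each `z` of the
factorisation through the stem `β`; they are compatible with each other because `β` is an
epimorphism. -/
theorem compatible_toStep_comp (h₁ : ∀ (c : P.K) (w : P.V c), Epi (P.vert c w).β)
    (g : P.step A q ⟶ X) : P.Compatible q (P.toStep A q ≫ g) := by
  intro c v w hw
  have := h₁ c v
  have key : ∀ z : P.Es c, ∃ k : (P.vert c v).D' ⟶ X.obj ((P.diag c).obj z),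
      (P.vert c v).β ≫ k = w ≫ P.limMap c (P.toStep A q ≫ g) ≫ P.proj c X z := by
    intro z
    have hu := IsQuotientCell.mk (q := q) c v w hw z _ (𝟙 _)
    refine ⟨(P.tome A q).fill (.inr (Quotient.mk _ ⟨c, v⟩)) ⟨_, hu⟩ ≫ g.app _, ?_⟩
    have h := (P.tome A q).fill_fac (.inr (Quotient.mk _ ⟨c, v⟩)) ⟨_, hu⟩
    refine (Category.assoc _ _ _).symm.trans ((congrArg (· ≫ g.app _) h).trans ?_)
    change ((w ≫ P.proj c A z ≫ A.map (𝟙 _)) ≫ (P.toStep A q).app _) ≫ g.app _ = _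
    rw [limMap_proj]
    simp
  choose k hk using key
  let s : Cone (P.diag c ⋙ X) :=
    { pt := (P.vert c v).D'
      π :=
        { app := k
          naturality := by
            intro z z' t
            rw [← cancel_epi (P.vert c v).β]
            have := P.proj_map c X t
            simp [hk, reassoc_of% hk, this] } }
  refine ⟨limit.lift _ s, limit.hom_ext fun z => ?_⟩
  rw [Category.assoc, limit.lift_π, Category.assoc]
  exact hk z

/-- Compatibility with the rectification says that the cells attached for the lifting problems posed
to `A` are sent to solutions. -/
theorem compatible_rectification_iff (g : P.step A q ⟶ X) :
    P.Compatible (P.rectification A q) g ↔ ∀ (c : P.K) (v : P.V c) (a : P.Problem A c v),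
      (a.map (P.toStep A q ≫ g)).IsSolution (P.π₀ q a ≫ g.app (P.ou c)) := by
  have hδ₁ {c : P.K} {v : P.V c} (a : P.Problem A c v) :
      (P.vert c v).δ₁ ≫ P.obstruction q a ≫ P.limMap c g =
        a.y ≫ P.limMap c (P.toStep A q ≫ g) := by
    rw [obstruction, IsPushout.inl_desc_assoc, limMap_comp, Category.assoc]
  have hδ₂ {c : P.K} {v : P.V c} (a : P.Problem A c v) :
      (P.vert c v).δ₂ ≫ P.obstruction q a ≫ P.limMap c g =
        (P.π₀ q a ≫ g.app (P.ou c)) ≫ P.can c X := by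
    rw [obstruction, IsPushout.inr_desc_assoc, Category.assoc, Category.assoc, can_naturality]
  constructor
  · intro H c v a
    obtain ⟨k, hk⟩ := H c v _ ⟨a, rfl⟩
    refine ⟨?_, k, ?_, ?_⟩
    · rw [← Category.assoc, π₀_fac]
      simp
    · rw [Vertebra.β₁, Category.assoc, hk, hδ₁]
      rfl
    · rw [Vertebra.β₂, ← hδ₂, Category.assoc, hk]
  · rintro H c v _ ⟨a, rfl⟩
    obtain ⟨-, k, hk, hk'⟩ := H c v a
    refine ⟨k, (P.vert c v).isPushout.hom_ext ?_ ?_⟩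
    · rw [hδ₁, ← Category.assoc]
      exact hk
    · rw [hδ₂, ← Category.assoc]
      exact hk'.symm

/-- An arrow out of `[A/q]` that is compatible with the rectification is determined by its
restriction to `A`: on the analytic cells solutions of lifting problems in `X` are unique, and on the
quotient cells the stems are epimorphisms. Without the compatibility, the value on an analytic cell
need not be part of a solution. -/
theorem step_hom_ext (h₁ : ∀ (c : P.K) (w : P.V c), Epi (P.vert c w).β)
    (h₂ : ∀ c : P.K, Mono (P.can c X))
    (h₃ : ∀ (c : P.K) (w : P.V c), Epi (P.vert c w).β₁) {g g' : P.step A q ⟶ X}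
    (h : P.toStep A q ≫ g = P.toStep A q ≫ g')
    (hg : P.Compatible (P.rectification A q) g) (hg' : P.Compatible (P.rectification A q) g') :
    g = g' := by
  rw [compatible_rectification_iff] at hg hg'
  refine (P.tome A q).realisation_hom_ext h ?_
  rintro (⟨c, v, a⟩ | b) d s
  · have := h₂ c
    have := h₃ c v
    have e := hg c v a
    rw [h] at e
    have e' := e.eq (hg' c v a)
    have hb (g : P.step A q ⟶ X) :
        (P.tome A q).fill (.inl ⟨c, v, a⟩) s ≫ g.app d =
          (P.π₀ q a ≫ g.app (P.ou c)) ≫ X.map s := by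
      refine (congrArg (· ≫ g.app d) (P.fill_inl q a s)).trans ((Category.assoc _ _ _).trans ?_)
      exact (congrArg (P.π₀ q a ≫ ·) (g.naturality s)).trans (Category.assoc _ _ _).symm
    exact (hb g).trans (e' ▸ (hb g').symm)
  · have hfac := (P.tome A q).fill_fac (.inr b) s
    have hb (g : P.step A q ⟶ X) :
        ((P.tome A q).arr (.inr b)).hom ≫ (P.tome A q).fill (.inr b) s ≫ g.app d =
          s.1 ≫ (P.toStep A q ≫ g).app d :=
      (Category.assoc _ _ _).symm.trans ((congrArg (· ≫ g.app d) hfac).trans (Category.assoc _ _ _))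
    exact (P.epi_stem h₁ b).left_cancellation _ _ ((hb g).trans (h ▸ (hb g').symm))

/-- A compatible arrow `A ⟶ X` to a model extends to a compatible arrow `[A/q] ⟶ X`: solutions of the
lifting problems in `X` give the values on the analytic cells, and the factorisations through the
stems those on the quotient cells. -/
theorem exists_step_desc (hX : P.IsModel X)
    (h₁ : ∀ (c : P.K) (w : P.V c), Epi (P.vert c w).β) {f : A ⟶ X} (hf : P.Compatible q f) :
    ∃ g : P.step A q ⟶ X, P.toStep A q ≫ g = f ∧ P.Compatible (P.rectification A q) g := by
  have hsol (c : P.K) (v : P.V c) (a : P.Problem A c v) : ∃ h, (a.map f).IsSolution h := by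
    obtain ⟨h, k, e₁, e₂, e₃⟩ := hX c v _ _ (a.map f).comm
    exact ⟨h, e₁, k, e₂, e₃⟩
  choose h hh using hsol
  have hstem (b : P.Stems) (d : D) (u : (P.quotientCell q b).toFunctor.obj d) :=
    hf.exists_stem_fac u.2
  choose k hk using hstem
  obtain ⟨g, hg, hg'⟩ := (P.tome A q).exists_realisation_desc f
    (fun i d => match i with
      | .inl a => fun (t : P.ou a.1 ⟶ d) => h a.1 a.2.1 a.2.2 ≫ X.map t
      | .inr b => k b d)
    (by
      rintro (⟨c, v, a⟩ | b) d s
      · change (P.vert c v).γ₂ ≫ h c v a ≫ X.map s = (a.x ≫ A.map s) ≫ f.app d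
        rw [← Category.assoc, (hh c v a).1, Problem.map_x, Category.assoc, Category.assoc]
        exact congrArg (a.x ≫ ·) (f.naturality s).symm
      · exact hk b d s)
    (by
      rintro (⟨c, v, a⟩ | b) d d' t s
      · exact (Category.assoc _ _ _).trans (congrArg (h c v a ≫ ·) (X.map_comp s t).symm)
      · have := P.epi_stem h₁ b
        refine this.left_cancellation _ _ ?_
        refine Eq.trans ?_ (hk b d' _).symm
        refine (Category.assoc _ _ _).symm.trans ((congrArg (· ≫ X.map t) (hk b d s)).trans ?_)
        change (s.1 ≫ f.app d) ≫ X.map t = (s.1 ≫ A.map t) ≫ f.app d'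
        rw [Category.assoc, Category.assoc, f.naturality])
  refine ⟨g, hg, (P.compatible_rectification_iff g).2 fun c v a => ?_⟩
  have e : P.π₀ q a ≫ g.app (P.ou c) = h c v a :=
    (hg' (.inl ⟨c, v, a⟩) _ (𝟙 (P.ou c))).trans
      ((congrArg (h c v a ≫ ·) (X.map_id _)).trans (Category.comp_id _))
  rw [e]
  exact hg ▸ hh c v a

end

/-! ### Extension along `A ⟶ A_ω` and its iterates -/

/-- The arrow `Aₙ ⟶ A_ω`. -/
noncomputable def ιOmegaStage (A : D ⥤ C) (n : ℕ) : (P.stage A n).1 ⟶ P.omegaStage A :=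
  colimit.ι (P.chain A) n

theorem chain_map_succ (A : D ⥤ C) (n : ℕ) :
    (P.chain A).map (homOfLE (Nat.le_add_right n 1)) =
      P.toStep (P.stage A n).1 (P.stage A n).2 :=
  Functor.ofSequence_map_homOfLE_succ _ n

theorem toStep_ιOmegaStage (A : D ⥤ C) (n : ℕ) :
    P.toStep (P.stage A n).1 (P.stage A n).2 ≫ P.ιOmegaStage A (n + 1) = P.ιOmegaStage A n :=
  (congrArg (· ≫ colimit.ι (P.chain A) (n + 1)) (P.chain_map_succ A n)).symm.trans
    (colimit.w (P.chain A) _)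

theorem toStep_ιOmegaStage_comp (A : D ⥤ C) (n : ℕ) {X : D ⥤ C} (g : P.omegaStage A ⟶ X) :
    P.toStep (P.stage A n).1 (P.stage A n).2 ≫ P.ιOmegaStage A (n + 1) ≫ g =
      P.ιOmegaStage A n ≫ g :=
  (Category.assoc _ _ _).symm.trans (congrArg (· ≫ g) (P.toStep_ιOmegaStage A n))

/-- Every arrow from `A` to the model `X` extends uniquely to `A_ω`. Uniqueness at stage `n + 1` uses
an extension to stage `n + 2`: the quotient cells attached there force compatibility with `qₙ₊₁`. -/
theorem existsUnique_omegaStage_desc {X : D ⥤ C} (hX : P.IsModel X)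
    (h₁ : ∀ (c : P.K) (w : P.V c), Epi (P.vert c w).β)
    (h₂ : ∀ c : P.K, Mono (P.can c X))
    (h₃ : ∀ (c : P.K) (w : P.V c), Epi (P.vert c w).β₁) (A : D ⥤ C) (f : A ⟶ X) :
    ∃! g : P.omegaStage A ⟶ X, P.toOmegaStage A ≫ g = f := by
  apply existsUnique_of_exists_of_unique
  · -- The quotient on the initial stage is empty, so `f` is compatible with it, and compatible
    -- extensions can be chosen recursively.
    choose next hnext hnext' using fun (n : ℕ) (g : (P.stage A n).1 ⟶ X)
      (hg : P.Compatible (P.stage A n).2 g) => P.exists_step_desc hX h₁ hg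
    let φ (n : ℕ) : { g : (P.stage A n).1 ⟶ X // P.Compatible (P.stage A n).2 g } :=
      Nat.rec ⟨f, fun _ _ _ hw => hw.elim⟩ (fun n g => ⟨next n g.1 g.2, hnext' n g.1 g.2⟩) n
    let s : Cocone (P.chain A) :=
      { pt := X
        ι := NatTrans.ofSequence (fun n => (φ n).1) (fun n => by
          rw [P.chain_map_succ]
          exact (hnext n (φ n).1 (φ n).2).trans (Category.comp_id _).symm) }
    exact ⟨colimit.desc _ s, colimit.ι_desc s 0⟩
  · intro g g' hg hg'
    have hcomp (g : P.omegaStage A ⟶ X) (n : ℕ) :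
        P.Compatible (P.stage A n).2 (P.ιOmegaStage A n ≫ g) := by
      rw [← toStep_ιOmegaStage_comp]
      exact P.compatible_toStep_comp h₁ _
    have key (n : ℕ) : P.ιOmegaStage A n ≫ g = P.ιOmegaStage A n ≫ g' := by
      induction n with
      | zero => exact hg.trans hg'.symm
      | succ n ih =>
        refine P.step_hom_ext h₁ h₂ h₃ ?_ (hcomp g (n + 1)) (hcomp g' (n + 1))
        exact (P.toStep_ιOmegaStage_comp A n g).trans
          (ih.trans (P.toStep_ιOmegaStage_comp A n g').symm)
    exact colimit.hom_ext key

end PremodelSystem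

theorem theorem1p1 {D : Type v} [SmallCategory D] {C : Type u} [Category.{v} C] [HasColimits C]
    (P : PremodelSystem D C) [∀ c, HasLimitsOfShape (P.Es c) C]
    (κ : Ordinal.{v}) (hκ : Order.IsSuccLimit κ) (A X : D ⥤ C) (hX : P.IsModel X) (f : A ⟶ X)
    (h₁ : ∀ (c : P.K) (w : P.V c), Epi (P.vert c w).β)
    (h₂ : ∀ c : P.K, Mono (P.can c X))
    (h₃ : ∀ (c : P.K) (w : P.V c), Epi (P.vert c w).β₁) :
    ∃! g : P.Q κ A ⟶ X, P.toQ κ A ≫ g = f := by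
  -- `P.toQ κ A` is a transfinite composite of arrows `B ⟶ B_ω`, and unique extension of arrows to
  -- `X` is inherited by transfinite composites.
  have hsucc : (P.iter A).prop ≤ ObjectProperty.isLocal (· = X) := by
    rintro B _ _ ⟨⟩ _ rfl
    exact Function.bijective_iff_existsUnique _ |>.2
      (P.existsUnique_omegaStage_desc hX h₁ h₂ h₃ B)
  have hloc : ObjectProperty.isLocal (· = X) (P.toQ κ A) :=
    MorphismProperty.transfiniteCompositionsOfShape_le _ _ _
      (((P.iter A).transfiniteCompositionOfShapeιIteration _).ofLE hsucc).mem
  exact Function.bijective_iff_existsUnique _ |>.1 (hloc X rfl) f
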